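/- A self-similar group $(G,\mathfrak B)$ is a group $G$ with a set $\mathfrak B$ carrying commuting left and right actions of $G$ such that the right action is free and has finitely many orbits. A basis is a set $\mathsf X\subset\mathfrak B$ that meets every right orbit exactly once. For $g\in G$ and $x\in\mathsf X$ write $g\cdot x=g(x)\cdot g|_x$ with $g(x)\in\mathsf X$, $g|_x\in G$, and extend this to finite words by $g(xv)=g(x)\,g|_x(v)$, $g|_{xv}=(g|_x)|_v$; this defines an action of $G$ on the rooted tree $\mathsf X^*$ of finite words. $(G,\mathfrak B)$ is faithful if only $1\in G$ acts trivially on $\mathsf X^*$. It is contracting if, for some basis $\mathsf X$, there is a finite set $\mathcal N\subset G$ such that for every $g\in G$ there is $n$ with $g|_v\in\mathcal N$ for all words $v$ of length at least $n$; this is then true for every basis, and the smallest such $\mathcal N$ is the nucleus (with respect to the basis). The limit space is the quotient of the space $\mathsf X^{-\omega}$ of left-infinite sequences (with the product topology of discrete spaces) by the relation that identifies $\ldots x_2x_1$ with $\ldots y_2y_1$ if there is a sequence $g_n$ taking values in a finite subset of $G$ with $g_n(x_n\ldots x_1)=y_n\ldots y_1$ for all $n$. **Theorem.** Let $(G,\mathfrak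 B)$ be a contracting self-similar group, and let $\mathsf X$ be any basis of $\mathfrak B$. Consider the conditions 1. the limit space of $(G,\mathfrak B)$ is zero-dimensional, that is, every open cover of it has an open refinement (again a cover) such that every point lies in at most one of its elements; 2. $G$ is locally finite, that is, every finitely generated subgroup of $G$ is finite; 3. the subgroup of $G$ generated by the nucleus is finite. If $(G,\mathfrak B)$ is faithful, then the three conditions are equivalent. Without faithfulness, (2) implies (3) and (3) implies (1). -/

import Mathlib

namespace SelfSim

open scoped RightActions

universe u v

/-- A self-similar group `(G, B)`: the set `B` carries commuting left and right actions of `G`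
(the right action is an action of `Gᵐᵒᵖ`, and `b <• g` is the right translate of `b` by `g`),
the right action is free and has finitely many orbits. -/
class IsSelfSimilarGroup (G : Type u) (B : Type v) [Group G] [MulAction G B] [MulAction Gᵐᵒᵖ B]
    [SMulCommClass G Gᵐᵒᵖ B] : Prop where
  free : ∀ (b : B) (g : G), b <• g = b → g = 1
  finite_orbits : Finite (MulAction.orbitRel.Quotient Gᵐᵒᵖ B)

/-- A basis of the biset `B`: a subset that intersects every right orbit exactly once. -/
def IsBasis (G : Type u) (B : Type v) [Group G] [MulAction Gᵐᵒᵖ B] (X : Set B) : Prop :=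
  ∀ b : B, ∃! x : B, x ∈ X ∧ x ∈ MulAction.orbit Gᵐᵒᵖ b

noncomputable section

namespace IsBasis

section Decomposition

variable {G : Type u} {B : Type v} [Group G] [MulAction Gᵐᵒᵖ B] {X : Set B}

theorem exists_decomp (hX : IsBasis G B X) (b : B) :
    ∃ p : X × G, b = (p.1 : B) <• p.2 := by
  obtain ⟨x, ⟨hx, ⟨g, hg⟩⟩, -⟩ := hX b
  refine ⟨(⟨x, hx⟩, (MulOpposite.unop g)⁻¹), ?_⟩
  simp only at hg ⊢
  rw [← hg, MulOpposite.op_inv, MulOpposite.op_unop, inv_smul_smul]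

/-- The decomposition `b = x · g` of `b` with `x` in the basis and `g` in `G`. -/
def decomp (hX : IsBasis G B X) (b : B) : X × G := (hX.exists_decomp b).choose

theorem decomp_spec (hX : IsBasis G B X) (b : B) :
    b = ((hX.decomp b).1 : B) <• (hX.decomp b).2 := (hX.exists_decomp b).choose_spec

end Decomposition

variable {G : Type u} {B : Type v} [Group G] [MulAction G B] [MulAction Gᵐᵒᵖ B]
  [SMulCommClass G Gᵐᵒᵖ B] {X : Set B}

theorem decomp_unique [h : IsSelfSimilarGroup G B] (hX : IsBasis G B X) {b : B} {x : X} {g : G}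
    (hb : b = (x : B) <• g) : hX.decomp b = (x, g) := by
  have hs := hX.decomp_spec b
  have hx : ((hX.decomp b).1 : B) = x := by
    refine (hX b).unique ⟨(hX.decomp b).1.2, ?_⟩ ⟨x.2, ?_⟩
    · refine ⟨(MulOpposite.op (hX.decomp b).2)⁻¹, ?_⟩
      simp only
      rw [inv_smul_eq_iff]
      exact hs
    · refine ⟨(MulOpposite.op g)⁻¹, ?_⟩
      simp only
      rw [inv_smul_eq_iff]
      exact hb
  have hg : (hX.decomp b).2 = g := by
    rw [hx, hb] at hs
    rw [hX.decomp_spec b, hx] at hb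
    have h1 : (x : B) <• ((hX.decomp b).2 * g⁻¹) = x := by
      rw [MulOpposite.op_mul, mul_smul, hb, MulOpposite.op_inv, inv_smul_smul]
    exact mul_inv_eq_one.mp (h.free _ _ h1)
  exact Prod.ext (Subtype.ext hx) hg

/-- The letter `σ_g(x)` in `g · x = σ_g(x) · g|_x`. -/
def letterAct (hX : IsBasis G B X) (g : G) (x : X) : X := (hX.decomp (g • (x : B))).1

/-- The section `g|_x` in `g · x = σ_g(x) · g|_x`. -/
def letterSection (hX : IsBasis G B X) (g : G) (x : X) : G := (hX.decomp (g • (x : B))).2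

/-- The action `v ↦ g(v)` of `G` on the rooted tree of finite words over the basis; the list
`[x₁, …, xₙ]` is the word `x₁ ⊗ ⋯ ⊗ xₙ`, and `g(x v) = σ_g(x) g|_x(v)`. -/
def act (hX : IsBasis G B X) : G → List X → List X
  | _, [] => []
  | g, x :: v => hX.letterAct g x :: act hX (hX.letterSection g x) v

/-- The section `g|_v` of `g` in the finite word `v`, so that `g · v = g(v) · g|_v`. -/
def sect (hX : IsBasis G B X) : G → List X → G
  | g, [] => g
  | g, x :: v => sect hX (hX.letterSection g x) v

theorem letter_spec (hX : IsBasis G B X) (g : G) (x : X) :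
    g • (x : B) = (hX.letterAct g x : B) <• hX.letterSection g x := hX.decomp_spec _

theorem letter_one [IsSelfSimilarGroup G B] (hX : IsBasis G B X) (x : X) :
    hX.letterAct 1 x = x ∧ hX.letterSection 1 x = 1 := by
  have : (hX.decomp ((1 : G) • (x : B))) = (x, 1) := hX.decomp_unique (by simp)
  exact ⟨congrArg Prod.fst this, congrArg Prod.snd this⟩

theorem letter_mul [IsSelfSimilarGroup G B] (hX : IsBasis G B X) (g h : G) (x : X) :
    hX.letterAct (g * h) x = hX.letterAct g (hX.letterAct h x) ∧
    hX.letterSection (g * h) x =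
      hX.letterSection g (hX.letterAct h x) * hX.letterSection h x := by
  have : hX.decomp ((g * h) • (x : B)) = (hX.letterAct g (hX.letterAct h x),
      hX.letterSection g (hX.letterAct h x) * hX.letterSection h x) := by
    apply hX.decomp_unique
    rw [mul_smul, hX.letter_spec h x, smul_comm, hX.letter_spec g, MulOpposite.op_mul, mul_smul]
  unfold letterAct letterSection at this ⊢
  rw [this]
  exact ⟨rfl, rfl⟩

theorem act_one [IsSelfSimilarGroup G B] (hX : IsBasis G B X) (v : List X) :
    hX.act 1 v = v := by
  induction v with
  | nil => rfl
  | cons x v ih => rw [act, (hX.letter_one x).1, (hX.letter_one x).2, ih]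

theorem act_mul [IsSelfSimilarGroup G B] (hX : IsBasis G B X) (g h : G) (v : List X) :
    hX.act (g * h) v = hX.act g (hX.act h v) := by
  induction v generalizing g h with
  | nil => rfl
  | cons x v ih =>
    rw [act, act, act, (hX.letter_mul g h x).1, (hX.letter_mul g h x).2, ih]

/-- The self-similar group is faithful: only the identity acts trivially on the rooted tree. -/
def IsFaithful (hX : IsBasis G B X) : Prop :=
  ∀ g : G, (∀ v : List X, hX.act g v = v) → g = 1

/-- For every `g` the sections `g|_v` in all sufficiently long words `v` belong to `N`. -/
def Absorbs (hX : IsBasis G B X) (N : Set G) : Prop :=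
  ∀ g : G, ∃ n : ℕ, ∀ v : List X, n ≤ v.length → hX.sect g v ∈ N

/-- The nucleus: the intersection of all finite absorbing sets. It is the smallest finite absorbing
set when there is one, see `isLeast_nucleus`. -/
def nucleus (hX : IsBasis G B X) : Set G :=
  ⋂₀ {N : Set G | N.Finite ∧ hX.Absorbs N}

theorem isLeast_nucleus (hX : IsBasis G B X) (h : ∃ N : Set G, N.Finite ∧ hX.Absorbs N) :
    IsLeast {N : Set G | N.Finite ∧ hX.Absorbs N} hX.nucleus := by
  refine ⟨?_, fun N hN => Set.sInter_subset_of_mem hN⟩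
  obtain ⟨N, hN, hNa⟩ := h
  refine ⟨hN.subset (Set.sInter_subset_of_mem ⟨hN, hNa⟩), fun g => ?_⟩
  have key : ∀ y ∈ N \ hX.nucleus, ∃ n : ℕ, ∀ v : List X, n ≤ v.length → hX.sect g v ≠ y := by
    rintro y ⟨-, hy⟩
    simp only [nucleus, Set.mem_sInter, not_forall] at hy
    obtain ⟨M, hM, hyM⟩ := hy
    obtain ⟨n, hn⟩ := hM.2 g
    exact ⟨n, fun v hv e => hyM (e ▸ hn v hv)⟩
  choose! f hf using key
  obtain ⟨n₀, hn₀⟩ := hNa g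
  obtain ⟨m, hm⟩ := ((hN.subset Set.sdiff_subset).image f : (f '' (N \ hX.nucleus)).Finite).bddAbove
  refine ⟨max n₀ m, fun v hv => ?_⟩
  by_contra hc
  have hmem : hX.sect g v ∈ N \ hX.nucleus := ⟨hn₀ v (le_trans (le_max_left _ _) hv), hc⟩
  exact hf _ hmem v ((hm ⟨_, hmem, rfl⟩).trans ((le_max_right _ _).trans hv)) rfl

end IsBasis

/-- The self-similar group `(G, B)` is contracting: for some basis there is a finite set that
contains the sections of every `g` in all sufficiently long words. -/
def IsContracting (G : Type u) (B : Type v) [Group G] [MulAction G B] [MulAction Gᵐᵒᵖ B]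
    [SMulCommClass G Gᵐᵒᵖ B] : Prop :=
  ∃ (X : Set B) (hX : IsBasis G B X) (N : Set G), N.Finite ∧ hX.Absorbs N

/-- Left-infinite sequences `… x₃ x₂ x₁` over the alphabet `A`; the value at `n` is `x_{n+1}`. -/
def LeftSeq (A : Type v) : Type v := ℕ → A

/-- The product topology of the discrete topologies on the alphabet. -/
instance (A : Type v) : TopologicalSpace (LeftSeq A) :=
  @Pi.topologicalSpace ℕ (fun _ => A) (fun _ => ⊥)

/-- The word `xₙ … x₂ x₁`. -/
def LeftSeq.ending {A : Type v} (x : LeftSeq A) : ℕ → List A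
  | 0 => []
  | n + 1 => x n :: LeftSeq.ending x n

namespace IsBasis

variable {G : Type u} {B : Type v} [Group G] [MulAction G B] [MulAction Gᵐᵒᵖ B]
  [SMulCommClass G Gᵐᵒᵖ B] [IsSelfSimilarGroup G B] {X : Set B}

/-- Asymptotic equivalence of left-infinite sequences: there are a finite set `F ⊆ G` and elements
`gₙ ∈ F` with `gₙ(xₙ … x₁) = yₙ … y₁` for all `n`. -/
def asymptotic (hX : IsBasis G B X) : Setoid (LeftSeq X) where
  r x y := ∃ F : Set G, F.Finite ∧ ∀ n : ℕ, ∃ g ∈ F, hX.act g (x.ending n) = y.ending n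
  iseqv :=
    { refl := fun x => ⟨{1}, Set.finite_singleton 1, fun n => ⟨1, rfl, hX.act_one _⟩⟩
      symm := by
        rintro x y ⟨F, hF, h⟩
        refine ⟨(fun g => g⁻¹) '' F, hF.image _, fun n => ?_⟩
        obtain ⟨g, hg, e⟩ := h n
        exact ⟨g⁻¹, ⟨g, hg, rfl⟩, by rw [← e, ← hX.act_mul, inv_mul_cancel, hX.act_one]⟩
      trans := by
        rintro x y z ⟨F, hF, h⟩ ⟨F', hF', h'⟩
        refine ⟨Set.image2 (fun a b => a * b) F' F, hF'.image2 _ hF, fun n => ?_⟩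
        obtain ⟨g, hg, e⟩ := h n
        obtain ⟨g', hg', e'⟩ := h' n
        exact ⟨g' * g, ⟨g', hg', g, hg, rfl⟩, by rw [hX.act_mul, e, e']⟩ }

/-- The limit space: left-infinite sequences modulo asymptotic equivalence, with the quotient
topology. -/
def LimitSpace (hX : IsBasis G B X) : Type v := Quotient hX.asymptotic

instance (hX : IsBasis G B X) : TopologicalSpace hX.LimitSpace :=
  inferInstanceAs (TopologicalSpace (Quotient hX.asymptotic))

end IsBasis

end

/-- Lebesgue covering dimension at most `d`: every open cover has an open refinement such that every
point lies in at most `d + 1` of its elements. -/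
def CoveringDimLE (T : Type v) [TopologicalSpace T] (d : ℕ) : Prop :=
  ∀ U : Set (Set T), (∀ s ∈ U, IsOpen s) → ⋃₀ U = Set.univ →
    ∃ V : Set (Set T), (∀ s ∈ V, IsOpen s) ∧ ⋃₀ V = Set.univ ∧
      (∀ s ∈ V, ∃ t ∈ U, s ⊆ t) ∧
      ∀ p : T, {s ∈ V | p ∈ s}.encard ≤ d + 1

/-- Zero-dimensional: covering dimension at most `0`. -/
def IsZeroDimensional (T : Type v) [TopologicalSpace T] : Prop := CoveringDimLE T 0

/-- A group is locally finite if all its finitely generated subgroups are finite. -/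
def IsLocallyFinite (G : Type u) [Group G] : Prop :=
  ∀ H : Subgroup G, H.FG → Finite H

end SelfSim

/-! Write `N` for the nucleus and `H` for the subgroup it generates. Since `N` is finite, local
finiteness makes `H` finite.

If `H` is finite, it is a finite absorbing set closed under sections, so asymptotic equivalence
means being related by `H` on every level. On one level this is an equivalence relation with clopen
classes, and these descend to a partition of the limit space; by compactness a deep enough level
refines a given open cover.

The hard step goes from dimension zero to finiteness of `H`. Every sequence has an ending `u` such
that the elements of `N³` fixing `u` have their sections at `u` in a set `C ⊆ N³` closed under
multiplication (`exists_isotropy`). A disjoint refinement of the corresponding neighborhoods, with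
compactness, sorts the words of some length `m` into `N`-invariant sets, each with all its endings
in `N(u)` for one such `u`. Comparing every ending with `u`, the sections of a product of elements
of `N` telescope into a product in `C`, so all sections of `H` on level `m` lie in `N·N³·N = N⁵`
(`sect_mem_of_invariant`).

Faithfulness enters through `IsFaithful.eq_of_level`: a set of elements with finitely many sections
on one level is finite. This gives finiteness of `H`, and also local finiteness once `H` is finite,
because deep sections of a finitely generated subgroup lie in `H`. -/

set_option linter.unusedSectionVars false

namespace SelfSim

open scoped RightActions Pointwise

/-! ### Calculus of sections; faithfulness -/

namespace IsBasis

section Words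

variable {G B : Type*} [Group G] [MulAction G B] [MulAction Gᵐᵒᵖ B] [SMulCommClass G Gᵐᵒᵖ B]
  {X : Set B}

@[simp] theorem length_act (hX : IsBasis G B X) (g : G) (v : List X) :
    (hX.act g v).length = v.length := by
  induction v generalizing g with
  | nil => rfl
  | cons x v ih => simp [act, ih]

theorem act_append (hX : IsBasis G B X) (g : G) (u v : List X) :
    hX.act g (u ++ v) = hX.act g u ++ hX.act (hX.sect g u) v := by
  induction u generalizing g with
  | nil => rfl
  | cons x u ih => simp [act, sect, ih]

theorem sect_append (hX : IsBasis G B X) (g : G) (u v : List X) :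
    hX.sect g (u ++ v) = hX.sect (hX.sect g u) v := by
  induction u generalizing g with
  | nil => rfl
  | cons x u ih => simp [sect, ih]

theorem act_append_eq_iff (hX : IsBasis G B X) (g : G) {u v u' v' : List X}
    (h : u.length = u'.length) :
    hX.act g (u ++ v) = u' ++ v' ↔ hX.act g u = u' ∧ hX.act (hX.sect g u) v = v' := by
  rw [act_append]
  exact ⟨fun e => List.append_inj e (by simpa using h), fun ⟨h₁, h₂⟩ => by rw [h₁, h₂]⟩

/-- The letters of a basis are representatives of the finitely many right orbits. -/
theorem finite [h : IsSelfSimilarGroup G B] (hX : IsBasis G B X) : Finite X := by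
  have := h.finite_orbits
  refine Finite.of_injective
    (fun x : X => (Quotient.mk _ (x : B) : MulAction.orbitRel.Quotient Gᵐᵒᵖ B)) fun x y hxy => ?_
  have hxy' : (x : B) ∈ MulAction.orbit Gᵐᵒᵖ (y : B) := Quotient.exact hxy
  exact Subtype.ext ((hX y).unique ⟨x.2, hxy'⟩ ⟨y.2, MulAction.mem_orbit_self _⟩)

variable [IsSelfSimilarGroup G B]

theorem sect_one (hX : IsBasis G B X) (v : List X) : hX.sect 1 v = 1 := by
  induction v with
  | nil => rfl
  | cons x v ih => rw [sect, (hX.letter_one x).2, ih]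

theorem sect_mul (hX : IsBasis G B X) (g h : G) (v : List X) :
    hX.sect (g * h) v = hX.sect g (hX.act h v) * hX.sect h v := by
  induction v generalizing g h with
  | nil => rfl
  | cons x v ih => rw [sect, act, sect, sect, (hX.letter_mul g h x).2, ih]

theorem act_inv_act (hX : IsBasis G B X) (g : G) (v : List X) :
    hX.act g⁻¹ (hX.act g v) = v := by
  rw [← act_mul, inv_mul_cancel, act_one]

theorem act_act_inv (hX : IsBasis G B X) (g : G) (v : List X) :
    hX.act g (hX.act g⁻¹ v) = v := by
  rw [← act_mul, mul_inv_cancel, act_one]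

theorem sect_inv_act (hX : IsBasis G B X) (g : G) (v : List X) :
    hX.sect g⁻¹ (hX.act g v) = (hX.sect g v)⁻¹ := by
  rw [eq_inv_iff_mul_eq_one, ← sect_mul, inv_mul_cancel, sect_one]

theorem sect_inv (hX : IsBasis G B X) (g : G) (v : List X) :
    hX.sect g⁻¹ v = (hX.sect g (hX.act g⁻¹ v))⁻¹ := by
  rw [← sect_inv_act, act_act_inv]

/-- A section of a product is a product of sections in words of the same length, so a bound for the
factors passes to powers. -/
theorem sect_mem_pow (hX : IsBasis G B X) {S T : Set G} {k : ℕ}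
    (h : ∀ g ∈ T, ∀ v : List X, k ≤ v.length → hX.sect g v ∈ S) (n : ℕ) :
    ∀ g ∈ T ^ n, ∀ v : List X, k ≤ v.length → hX.sect g v ∈ S ^ n := by
  induction n with
  | zero =>
    rintro g hg v -
    rw [pow_zero, Set.mem_one] at hg ⊢
    rw [hg, sect_one]
  | succ n ih =>
    intro g hg v hv
    rw [pow_succ] at hg ⊢
    obtain ⟨a, ha, b, hb, rfl⟩ := hg
    rw [sect_mul]
    exact Set.mul_mem_mul (ih a ha _ (by simpa using hv)) (h b hb v hv)

theorem Absorbs.eventually (hX : IsBasis G B X) {N F : Set G} (hN : hX.Absorbs N)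
    (hF : F.Finite) : ∃ k : ℕ, ∀ g ∈ F, ∀ v : List X, k ≤ v.length → hX.sect g v ∈ N := by
  have : ∀ᶠ k : ℕ in Filter.atTop, ∀ g ∈ F, ∀ v : List X, k ≤ v.length → hX.sect g v ∈ N := by
    refine (Filter.eventually_all_finite hF).2 fun g _ => ?_
    obtain ⟨n, hn⟩ := hN g
    filter_upwards [Filter.eventually_ge_atTop n] with k hk v hv using hn v (hk.trans hv)
  exact this.exists

/-- A finite set is contained in a finite set closed under sections. -/
theorem Absorbs.exists_section_closed (hX : IsBasis G B X) {N F : Set G} (hN : hX.Absorbs N)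
    (hNf : N.Finite) (hF : F.Finite) :
    ∃ S : Set G, S.Finite ∧ F ⊆ S ∧ ∀ g ∈ S, ∀ v : List X, hX.sect g v ∈ S := by
  have := hX.finite
  obtain ⟨k, hk⟩ := Absorbs.eventually hX hN hF
  -- All sections of `F`: those in words of length at least `k` lie in `N`, and there are finitely
  -- many shorter words.
  refine ⟨Set.image2 hX.sect F Set.univ, ?_, fun g hg => ⟨g, hg, [], trivial, rfl⟩, ?_⟩
  · refine (hNf.union (hF.image2 hX.sect (List.finite_length_lt X k))).subset ?_
    rintro _ ⟨g, hg, v, -, rfl⟩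
    by_cases hv : k ≤ v.length
    · exact Or.inl (hk g hg v hv)
    · exact Or.inr ⟨g, hg, v, not_le.1 hv, rfl⟩
  · rintro _ ⟨g, hg, u, -, rfl⟩ v
    exact ⟨g, hg, u ++ v, trivial, hX.sect_append g u v⟩

/-- Elements of a faithful self-similar group are determined by their action on a level of the tree
and by their sections there. -/
theorem IsFaithful.eq_of_level {hX : IsBasis G B X} (hf : hX.IsFaithful) (m : ℕ) {g h : G}
    (ha : ∀ v : List X, v.length = m → hX.act g v = hX.act h v)
    (hs : ∀ v : List X, v.length = m → hX.sect g v = hX.sect h v) : g = h := by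
  have long : ∀ u : List X, m ≤ u.length → hX.act g u = hX.act h u := by
    intro u hu
    have hl : (u.take m).length = m := by simpa using hu
    rw [← List.take_append_drop m u, act_append, act_append, ha _ hl, hs _ hl]
  have all : ∀ u : List X, hX.act g u = hX.act h u := by
    rintro (_ | ⟨x, u⟩)
    · rfl
    -- A short word is padded on the right to length at least `m`; its image is a prefix of the
    -- image of the padded word.
    · have := long ((x :: u) ++ List.replicate m x) (by simp; omega)
      rw [act_append, act_append] at this
      exact List.append_inj_left this (by simp)
  have := hf (h⁻¹ * g) fun v => by rw [act_mul, all, act_inv_act]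
  exact (inv_mul_eq_one.1 this).symm

/-- By `eq_of_level` an element is encoded by a function from the finite level `m` to pairs (image,
section), and only finitely many pairs occur. -/
theorem IsFaithful.finite_of_sect_mem {hX : IsBasis G B X} (hf : hX.IsFaithful) {S F : Set G}
    (hF : F.Finite) (m : ℕ) (h : ∀ g ∈ S, ∀ v : List X, v.length = m → hX.sect g v ∈ F) :
    S.Finite := by
  have := hX.finite
  have : Finite {v : List X // v.length = m} := List.finite_length_eq X m
  let Φ : G → {v : List X // v.length = m} → List X × G := fun g v => (hX.act g v, hX.sect g v)
  have hfin : (Set.pi Set.univ fun _ : {v : List X // v.length = m} =>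
      {v : List X | v.length = m} ×ˢ F).Finite :=
    Set.Finite.pi fun _ => (List.finite_length_eq X m).prod hF
  refine Set.Finite.of_injOn (f := Φ) ?_ (fun g _ g' _ e => ?_) hfin
  · intro g hg v _
    exact ⟨by simpa [Φ] using v.2, h g hg v v.2⟩
  · refine hf.eq_of_level m (fun v hv => ?_) fun v hv => ?_
    · exact congrArg Prod.fst (congrFun e ⟨v, hv⟩)
    · exact congrArg Prod.snd (congrFun e ⟨v, hv⟩)

end Words

end IsBasis

/-! ### Independence of the basis -/

namespace IsBasis

section BasisChange

variable {G B : Type*} [Group G] [MulAction G B] [MulAction Gᵐᵒᵖ B] [SMulCommClass G Gᵐᵒᵖ B]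
  {X Y : Set B}

/-- Rewriting a word over `X` in another basis `Y`: `v = w · h` with a word `w` over `Y` and `h` in
`G`. -/
noncomputable def convert (hY : IsBasis G B Y) : List X → List Y × G
  | [] => ([], 1)
  | x :: v =>
    ((hY.decomp x).1 :: hY.act (hY.decomp x).2 (convert hY v).1,
      hY.sect (hY.decomp x).2 (convert hY v).1 * (convert hY v).2)

@[simp] theorem length_convert (hY : IsBasis G B Y) (v : List X) :
    (hY.convert v).1.length = v.length := by
  induction v with
  | nil => rfl
  | cons x v ih => simp [convert, ih]

variable [IsSelfSimilarGroup G B]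

theorem convert_append (hY : IsBasis G B Y) (u v : List X) :
    hY.convert (u ++ v) =
      ((hY.convert u).1 ++ hY.act (hY.convert u).2 (hY.convert v).1,
        hY.sect (hY.convert u).2 (hY.convert v).1 * (hY.convert v).2) := by
  induction u with
  | nil => simp [convert, act_one, sect_one]
  | cons x u ih =>
    simp only [List.cons_append, convert, ih, act_append, sect_append, act_mul, sect_mul, mul_assoc]

theorem decomp_letter (hX : IsBasis G B X) (hY : IsBasis G B Y) (g : G) (x : X) :
    (hY.decomp (hX.letterAct g x : B)).1 = hY.letterAct g (hY.decomp (x : B)).1 ∧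
    (hY.decomp (hX.letterAct g x : B)).2 * hX.letterSection g x =
      hY.letterSection g (hY.decomp (x : B)).1 * (hY.decomp (x : B)).2 := by
  have h₁ : hY.decomp (g • (x : B)) = ((hY.decomp (hX.letterAct g x : B)).1,
      (hY.decomp (hX.letterAct g x : B)).2 * hX.letterSection g x) := by
    apply hY.decomp_unique
    rw [MulOpposite.op_mul, mul_smul, ← hY.decomp_spec, hX.letter_spec]
  have h₂ : hY.decomp (g • (x : B)) = (hY.letterAct g (hY.decomp (x : B)).1,
      hY.letterSection g (hY.decomp (x : B)).1 * (hY.decomp (x : B)).2) := by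
    apply hY.decomp_unique
    rw [MulOpposite.op_mul, mul_smul, ← hY.letter_spec, ← smul_comm, ← hY.decomp_spec]
  exact Prod.ext_iff.1 (h₁.symm.trans h₂)

/-- Both sides compute `g · v` in the basis `Y`: one rewrites after applying `g`, the other before.
Sections over the two bases thus differ only by the factors `(convert _).2`. -/
theorem convert_act (hX : IsBasis G B X) (hY : IsBasis G B Y) (g : G) (v : List X) :
    (hY.convert (hX.act g v)).1 = hY.act g (hY.convert v).1 ∧
    (hY.convert (hX.act g v)).2 * hX.sect g v =
      hY.sect g (hY.convert v).1 * (hY.convert v).2 := by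
  induction v generalizing g with
  | nil => simp [act, sect, convert]
  | cons x v ih =>
    obtain ⟨h₁, h₂⟩ := decomp_letter hX hY g x
    obtain ⟨i₁, i₂⟩ := ih (hX.letterSection g x)
    simp only [act, sect, convert]
    constructor
    · rw [h₁, i₁, ← act_mul, h₂, act_mul]
    · rw [mul_assoc, i₂, i₁, ← mul_assoc, ← sect_mul, h₂, sect_mul, mul_assoc]

theorem convert_snd_mem_pow (hY : IsBasis G B Y) {S : Set G}
    (hS : ∀ g ∈ S, ∀ v : List Y, hY.sect g v ∈ S) (hd : ∀ x : X, (hY.decomp (x : B)).2 ∈ S)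
    (v : List X) : (hY.convert v).2 ∈ S ^ v.length := by
  induction v with
  | nil => simp [convert]
  | cons x v ih =>
    rw [List.length_cons, pow_succ']
    exact Set.mul_mem_mul (hS _ (hd x) _) ih

theorem _root_.Set.Finite.pow_set {M : Type*} [Monoid M] {S : Set M} (hS : S.Finite) (n : ℕ) :
    (S ^ n).Finite := by
  induction n with
  | zero => exact Set.finite_one
  | succ n ih => exact pow_succ S n ▸ ih.mul hS

/-- The group elements that arise in a change of basis form a finite set. -/
theorem finite_convert_snd (hX : IsBasis G B X) (hY : IsBasis G B Y) {N : Set G} (hN : N.Finite)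
    (hNa : hY.Absorbs N) : ∃ D : Set G, D.Finite ∧ ∀ v : List X, (hY.convert v).2 ∈ D := by
  have := hX.finite
  obtain ⟨S, hSf, hS, hSs⟩ := Absorbs.exists_section_closed hY hNa hN
    (((Set.finite_range fun x : X => (hY.decomp (x : B)).2).union hN).insert 1)
  have h1 : (1 : G) ∈ S := hS (Set.mem_insert _ _)
  have hNS : N ⊆ S := fun g hg => hS (Or.inr (Or.inr hg))
  have hd : ∀ x : X, (hY.decomp (x : B)).2 ∈ S := fun x => hS (Or.inr (Or.inl ⟨x, rfl⟩))
  obtain ⟨k₀, hk₀⟩ := Absorbs.eventually hY hNa (hSf.pow_set 2)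
  obtain ⟨k, hk0, hk⟩ : ∃ k, 0 < k ∧ ∀ g ∈ S ^ 2, ∀ v : List Y, k ≤ v.length → hY.sect g v ∈ S :=
    ⟨k₀ + 1, by omega, fun g hg v hv => hNS (hk₀ g hg v (by omega))⟩
  -- Split off the last `k` letters. The element of the remaining word lies in `(S²)^k` by
  -- induction, its section in a word of length `k` lies in `S^k`, and the last `k` letters
  -- contribute another factor in `S^k`.
  refine ⟨S ^ (2 * k), hSf.pow_set _, fun v => ?_⟩
  induction hl : v.length using Nat.strong_induction_on generalizing v with
  | _ l ih =>
    by_cases hv : v.length ≤ k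
    · exact Set.pow_subset_pow_right h1 (by omega) (convert_snd_mem_pow hY hSs hd v)
    · have hlen : (v.drop (v.length - k)).length = k := by rw [List.length_drop]; omega
      have hu := convert_snd_mem_pow hY hSs hd (v.drop (v.length - k))
      rw [hlen] at hu
      have hi := ih _ (by rw [List.length_take]; omega) (v.take (v.length - k)) rfl
      rw [← List.take_append_drop (v.length - k) v, convert_append, two_mul, pow_add]
      rw [pow_mul] at hi
      exact Set.mul_mem_mul (hY.sect_mem_pow hk k _ hi _ (by rw [length_convert, hlen])) hu

/-- Being contracting does not depend on the basis. -/
theorem exists_absorbs (hX : IsBasis G B X) (h : IsContracting G B) :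
    ∃ N : Set G, N.Finite ∧ hX.Absorbs N := by
  obtain ⟨Y, hY, N, hN, hNa⟩ := h
  obtain ⟨D, hD, hDm⟩ := finite_convert_snd hX hY hN hNa
  refine ⟨D⁻¹ * (N * D), hD.inv.mul (hN.mul hD), fun g => ?_⟩
  obtain ⟨n, hn⟩ := hNa g
  refine ⟨n, fun v hv => ?_⟩
  rw [eq_inv_mul_of_mul_eq (convert_act hX hY g v).2]
  exact Set.mul_mem_mul (Set.inv_mem_inv.2 (hDm _))
    (Set.mul_mem_mul (hn _ (by rwa [length_convert])) (hDm _))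

end BasisChange

/-! ### The nucleus and the group it generates -/

section Nucleus

variable {G B : Type*} [Group G] [MulAction G B] [MulAction Gᵐᵒᵖ B] [SMulCommClass G Gᵐᵒᵖ B]
  {X : Set B}

theorem finite_nucleus (hX : IsBasis G B X) (h : ∃ N : Set G, N.Finite ∧ hX.Absorbs N) :
    hX.nucleus.Finite :=
  (hX.isLeast_nucleus h).1.1

theorem absorbs_nucleus (hX : IsBasis G B X) (h : ∃ N : Set G, N.Finite ∧ hX.Absorbs N) :
    hX.Absorbs hX.nucleus :=
  (hX.isLeast_nucleus h).1.2

/-- The nucleus consists of the elements that are sections of a fixed element in arbitrarily long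
words. -/
theorem mem_nucleus_iff (hX : IsBasis G B X) (h : ∃ N : Set G, N.Finite ∧ hX.Absorbs N) {g : G} :
    g ∈ hX.nucleus ↔ ∃ g₀ : G, ∀ n : ℕ, ∃ v : List X, n ≤ v.length ∧ hX.sect g₀ v = g := by
  constructor
  · intro hg
    by_contra! hc
    -- An element that is not a section in arbitrarily long words could be removed, against
    -- minimality.
    have : hX.nucleus ⊆ hX.nucleus \ {g} := by
      refine (hX.isLeast_nucleus h).2 ⟨(hX.finite_nucleus h).subset Set.sdiff_subset, fun g₀ => ?_⟩
      obtain ⟨n, hn⟩ := hX.absorbs_nucleus h g₀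
      obtain ⟨m, hm⟩ := hc g₀
      exact ⟨max n m, fun v hv => ⟨hn v ((le_max_left _ _).trans hv),
        hm v ((le_max_right _ _).trans hv)⟩⟩
    exact (this hg).2 rfl
  · rintro ⟨g₀, hg₀⟩
    obtain ⟨n, hn⟩ := hX.absorbs_nucleus h g₀
    obtain ⟨v, hv, rfl⟩ := hg₀ n
    exact hn v hv

theorem sect_mem_nucleus (hX : IsBasis G B X) (h : ∃ N : Set G, N.Finite ∧ hX.Absorbs N) {g : G}
    (hg : g ∈ hX.nucleus) (v : List X) : hX.sect g v ∈ hX.nucleus := by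
  rw [mem_nucleus_iff hX h] at hg ⊢
  obtain ⟨g₀, hg₀⟩ := hg
  refine ⟨g₀, fun n => ?_⟩
  obtain ⟨u, hu, rfl⟩ := hg₀ n
  exact ⟨u ++ v, by rw [List.length_append]; omega, hX.sect_append _ _ _⟩

/-- Iterating this backwards builds left-infinite sequences in `exists_asymptotic_of_mem_nucleus`.
-/
theorem exists_letterSection_eq_of_mem_nucleus (hX : IsBasis G B X)
    (h : ∃ N : Set G, N.Finite ∧ hX.Absorbs N) {g : G} (hg : g ∈ hX.nucleus) :
    ∃ g' ∈ hX.nucleus, ∃ x : X, hX.letterSection g' x = g := by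
  obtain ⟨g₀, hg₀⟩ := (mem_nucleus_iff hX h).1 hg
  obtain ⟨n, hn⟩ := hX.absorbs_nucleus h g₀
  obtain ⟨v, hv, hvg⟩ := hg₀ (n + 1)
  have hne : v ≠ [] := by
    rintro rfl
    simp at hv
  refine ⟨hX.sect g₀ v.dropLast, hn _ (by rw [List.length_dropLast]; omega), v.getLast hne, ?_⟩
  rw [← hvg]
  conv_rhs => rw [← List.dropLast_append_getLast hne, sect_append]
  rfl

variable [IsSelfSimilarGroup G B]

theorem one_mem_nucleus [Nonempty X] (hX : IsBasis G B X)
    (h : ∃ N : Set G, N.Finite ∧ hX.Absorbs N) : (1 : G) ∈ hX.nucleus :=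
  (mem_nucleus_iff hX h).2 ⟨1, fun n =>
    ⟨List.replicate n (Classical.arbitrary X), by simp, hX.sect_one _⟩⟩

theorem inv_mem_nucleus (hX : IsBasis G B X) (h : ∃ N : Set G, N.Finite ∧ hX.Absorbs N) {g : G}
    (hg : g ∈ hX.nucleus) : g⁻¹ ∈ hX.nucleus := by
  rw [mem_nucleus_iff hX h] at hg ⊢
  obtain ⟨g₀, hg₀⟩ := hg
  refine ⟨g₀⁻¹, fun n => ?_⟩
  obtain ⟨v, hv, rfl⟩ := hg₀ n
  exact ⟨hX.act g₀ v, by simpa using hv, hX.sect_inv_act _ _⟩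

theorem sect_mem_closure_nucleus (hX : IsBasis G B X)
    (h : ∃ N : Set G, N.Finite ∧ hX.Absorbs N) {g : G}
    (hg : g ∈ Subgroup.closure hX.nucleus) (v : List X) :
    hX.sect g v ∈ Subgroup.closure hX.nucleus := by
  induction hg using Subgroup.closure_induction generalizing v with
  | mem g hg => exact Subgroup.subset_closure (sect_mem_nucleus hX h hg v)
  | one => rw [sect_one]; exact one_mem _
  | mul a b _ _ ha hb => rw [sect_mul]; exact mul_mem (ha _) (hb _)
  | inv a _ ha => rw [sect_inv]; exact inv_mem (ha _)

/-- If the group generated by the nucleus of a faithful contracting group is finite, the group is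
locally finite. -/
theorem IsFaithful.isLocallyFinite {hX : IsBasis G B X} (hf : hX.IsFaithful)
    (h : ∃ N : Set G, N.Finite ∧ hX.Absorbs N) (hfin : Finite (Subgroup.closure hX.nucleus)) :
    IsLocallyFinite G := by
  rintro _ ⟨S, rfl⟩
  obtain ⟨k, hk⟩ := Absorbs.eventually hX (hX.absorbs_nucleus h) S.finite_toSet
  refine hf.finite_of_sect_mem (S := (Subgroup.closure (S : Set G) : Set G))
    (F := Subgroup.closure hX.nucleus) hfin k fun g hg v hv => ?_
  induction hg using Subgroup.closure_induction generalizing v with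
  | mem g hg => exact Subgroup.subset_closure (hk g hg v hv.ge)
  | one => rw [sect_one]; exact one_mem _
  | mul a b _ _ ha hb => rw [sect_mul]; exact mul_mem (ha _ (by simpa using hv)) (hb _ hv)
  | inv a _ ha => rw [sect_inv]; exact inv_mem (ha _ (by simpa using hv))

end Nucleus

end IsBasis

/-! ### Topology of left-infinite sequences -/

namespace LeftSeq

variable {A : Type*}

theorem ending_eq_iff {x y : LeftSeq A} {n : ℕ} :
    x.ending n = y.ending n ↔ ∀ i < n, x i = y i := by
  induction n with
  | zero => simp [ending]
  | succ n ih => rw [ending, ending, List.cons.injEq, ih, Nat.forall_lt_succ_right, and_comm]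

theorem exists_ending_add (n k : ℕ) (x : LeftSeq A) :
    ∃ p : List A, p.length = k ∧ x.ending (n + k) = p ++ x.ending n := by
  induction k with
  | zero => exact ⟨[], rfl, rfl⟩
  | succ k ih =>
    obtain ⟨p, hp, e⟩ := ih
    exact ⟨x (n + k) :: p, by rw [List.length_cons, hp], by rw [← add_assoc, ending, e]; rfl⟩

theorem ending_eq_of_le {x y : LeftSeq A} {m n : ℕ} (h : m ≤ n) (e : x.ending n = y.ending n) :
    x.ending m = y.ending m :=
  ending_eq_iff.2 fun i hi => ending_eq_iff.1 e i (hi.trans_le h)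

/-- A word continued to the left by a sequence. -/
theorem exists_ending_eq (w : List A) (s : ℕ → A) :
    ∃ x : LeftSeq A, x.ending w.length = w ∧ ∀ k, x (w.length + k) = s k := by
  induction w generalizing s with
  | nil => exact ⟨s, rfl, fun k => by simp⟩
  | cons a w ih =>
    obtain ⟨x, hx, hk⟩ := ih fun k => Nat.casesOn k a s
    refine ⟨x, ?_, fun k => ?_⟩
    · rw [List.length_cons, ending, hx]
      congr 1
      exact hk 0
    · rw [List.length_cons, add_assoc, add_comm 1 k]
      exact hk (k + 1)

theorem isOpen_iff {U : Set (LeftSeq A)} :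
    IsOpen U ↔ ∀ x ∈ U, ∃ n, ∀ y : LeftSeq A, y.ending n = x.ending n → y ∈ U := by
  let _ : TopologicalSpace A := ⊥
  have : DiscreteTopology A := ⟨rfl⟩
  have hb := PiNat.isTopologicalBasis_cylinders (E := fun _ : ℕ => A)
  refine hb.isOpen_iff.trans ⟨fun h x hx => ?_, fun h x hx => ?_⟩
  · obtain ⟨_, ⟨z, n, rfl⟩, hxz, hU⟩ := h x hx
    exact ⟨n, fun y hy => hU fun i hi => (ending_eq_iff.1 hy i hi).trans (hxz i hi)⟩
  · obtain ⟨n, hn⟩ := h x hx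
    exact ⟨_, ⟨x, n, rfl⟩, PiNat.self_mem_cylinder x n, fun y hy => hn y (ending_eq_iff.2 hy)⟩

theorem isOpen_setOf_ending (n : ℕ) (P : List A → Prop) :
    IsOpen {x : LeftSeq A | P (x.ending n)} :=
  isOpen_iff.2 fun x hx => ⟨n, fun y hy => by rwa [Set.mem_ofPred_eq, hy]⟩

instance [Finite A] : CompactSpace (LeftSeq A) := by
  let _ : TopologicalSpace A := ⊥
  exact inferInstanceAs (CompactSpace (ℕ → A))

/-- The form in which compactness is used: a level that depends on the sequence can be chosen
uniformly. -/
theorem exists_eq_univ [Finite A] (W : ℕ → Set (LeftSeq A)) (ho : ∀ n, IsOpen (W n))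
    (hm : Monotone W) (hc : ∀ x, ∃ n, x ∈ W n) : ∃ n, ∀ x, x ∈ W n := by
  obtain ⟨n, hn⟩ := isCompact_univ.elim_directed_cover W ho
    (fun x _ => Set.mem_iUnion.2 (hc x)) hm.directed_le
  exact ⟨n, fun x => hn trivial⟩

end LeftSeq

/-! ### Level relations and asymptotic equivalence -/

namespace IsBasis

variable {G B : Type*} [Group G] [MulAction G B] [MulAction Gᵐᵒᵖ B] [SMulCommClass G Gᵐᵒᵖ B]
  {X : Set B}

/-- The endings of length `n` of `x` and `y` are related by an element of `M`. -/
def LevelRel (hX : IsBasis G B X) (M : Set G) (n : ℕ) (x y : LeftSeq X) : Prop :=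
  ∃ g ∈ M, hX.act g (x.ending n) = y.ending n

theorem exists_sect_act_ending (hX : IsBasis G B X) {g : G} {n k : ℕ} {x y : LeftSeq X}
    (h : hX.act g (x.ending (n + k)) = y.ending (n + k)) :
    ∃ p : List X, p.length = k ∧ x.ending (n + k) = p ++ x.ending n ∧
      hX.act (hX.sect g p) (x.ending n) = y.ending n := by
  obtain ⟨p, hp, e⟩ := x.exists_ending_add n k
  obtain ⟨q, hq, e'⟩ := y.exists_ending_add n k
  rw [e, e', act_append_eq_iff _ _ (by rw [hp, hq])] at h
  exact ⟨p, hp, e, h.2⟩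

theorem LevelRel.of_le {hX : IsBasis G B X} {M : Set G}
    (hM : ∀ g ∈ M, ∀ v : List X, hX.sect g v ∈ M) {m n : ℕ} (hmn : m ≤ n) {x y : LeftSeq X}
    (h : hX.LevelRel M n x y) : hX.LevelRel M m x y := by
  obtain ⟨k, rfl⟩ := Nat.exists_eq_add_of_le hmn
  obtain ⟨g, hg, e⟩ := h
  obtain ⟨p, -, -, h⟩ := hX.exists_sect_act_ending e
  exact ⟨_, hM g hg p, h⟩

variable [IsSelfSimilarGroup G B]

/-- An open set that contains all sequences related to `z` on every level contains all sequences
related to `z` on some level. -/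
theorem exists_levelRel_subset (hX : IsBasis G B X) {M : Set G}
    (hM : ∀ g ∈ M, ∀ v : List X, hX.sect g v ∈ M) {W : Set (LeftSeq X)} (hW : IsOpen W)
    (z : LeftSeq X) (h : ∀ y, (∀ n, hX.LevelRel M n z y) → y ∈ W) :
    ∃ n, ∀ y, hX.LevelRel M n z y → y ∈ W := by
  have := hX.finite
  -- Being unrelated to `z` is an open condition that persists on deeper levels.
  obtain ⟨n, hn⟩ := LeftSeq.exists_eq_univ (fun n => W ∪ {y | ¬ hX.LevelRel M n z y})
    (fun n => hW.union (LeftSeq.isOpen_setOf_ending n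
      fun v => ¬ ∃ g ∈ M, hX.act g (z.ending n) = v))
    (fun m n hmn y hy => hy.imp_right fun hy h' => hy (h'.of_le hM hmn))
    (fun y => by
      by_cases hy : ∀ n, hX.LevelRel M n z y
      · exact ⟨0, Or.inl (h y hy)⟩
      · obtain ⟨n, hn⟩ := not_forall.1 hy
        exact ⟨n, Or.inr hn⟩)
  exact ⟨n, fun y hy => (hn y).resolve_right fun h' => h' hy⟩

/-- An element acting on the ending of length `n + k` acts on the ending of length `n` through its
section in the first `k` letters, which lies in `M` for large `k`. -/
theorem asymptotic_iff (hX : IsBasis G B X) {M : Set G} (hMf : M.Finite) (hM : hX.Absorbs M)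
    {x y : LeftSeq X} : hX.asymptotic x y ↔ ∀ n, hX.LevelRel M n x y := by
  constructor
  · rintro ⟨F, hF, h⟩ n
    obtain ⟨k, hk⟩ := Absorbs.eventually hX hM hF
    obtain ⟨g, hg, e⟩ := h (n + k)
    obtain ⟨p, hp, -, h'⟩ := hX.exists_sect_act_ending e
    exact ⟨_, hk g hg p hp.ge, h'⟩
  · exact fun h => ⟨M, hMf, h⟩

theorem isOpen_limitSpace_iff (hX : IsBasis G B X) {U : Set hX.LimitSpace} :
    IsOpen U ↔ IsOpen {x : LeftSeq X | (Quotient.mk hX.asymptotic x : hX.LimitSpace) ∈ U} :=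
  Iff.rfl

/-- Every element of the nucleus moves the ending of some sequence to that of an asymptotically
equivalent one, whatever the ending. -/
theorem exists_asymptotic_of_mem_nucleus (hX : IsBasis G B X)
    (h : ∃ N : Set G, N.Finite ∧ hX.Absorbs N) {g : G} (hg : g ∈ hX.nucleus) (w : List X) :
    ∃ x y : LeftSeq X, hX.asymptotic x y ∧ x.ending w.length = w ∧
      y.ending w.length = hX.act g w := by
  have : Nonempty X :=
    let ⟨_, _, x, _⟩ := hX.exists_letterSection_eq_of_mem_nucleus h hg
    ⟨x⟩
  choose! f hf t ht using fun g hg => hX.exists_letterSection_eq_of_mem_nucleus h (g := g) hg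
  -- A backward orbit of `g` in the nucleus: `a (k + 1)` has section `a k` in the letter `t (a k)`.
  -- These letters continue `w` to the left.
  let a : ℕ → G := fun k => f^[k] g
  have ha : ∀ k, a k ∈ hX.nucleus := by
    intro k
    induction k with
    | zero => exact hg
    | succ k ih => simpa only [a, Function.iterate_succ_apply'] using hf _ ih
  have hs : ∀ k, hX.letterSection (a (k + 1)) (t (a k)) = a k := fun k => by
    simpa only [a, Function.iterate_succ_apply'] using ht _ (ha k)
  obtain ⟨x, hx, hxk⟩ := LeftSeq.exists_ending_eq w fun k => t (a k)
  obtain ⟨y, hy, hyk⟩ := LeftSeq.exists_ending_eq (hX.act g w)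
    fun k => hX.letterAct (a (k + 1)) (t (a k))
  rw [length_act] at hy hyk
  have key : ∀ k, hX.act (a k) (x.ending (w.length + k)) = y.ending (w.length + k) := by
    intro k
    induction k with
    | zero => rw [add_zero, hx, hy]; rfl
    | succ k ih =>
      rw [← add_assoc, LeftSeq.ending, LeftSeq.ending, act, hxk, hyk, hs, ih]
  refine ⟨x, y, (hX.asymptotic_iff (hX.finite_nucleus h) (hX.absorbs_nucleus h)).2 fun n => ?_,
    hx, hy⟩
  exact LevelRel.of_le (fun g hg v => hX.sect_mem_nucleus h hg v) (Nat.le_add_left n w.length)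
    ⟨a n, ha n, key n⟩

/-- If the group generated by the nucleus is finite, the limit space is zero-dimensional. -/
theorem isZeroDimensional (hX : IsBasis G B X) (h : ∃ N : Set G, N.Finite ∧ hX.Absorbs N)
    (hfin : Finite (Subgroup.closure hX.nucleus)) : IsZeroDimensional hX.LimitSpace := by
  have := hX.finite
  set H := Subgroup.closure hX.nucleus with hH
  have hs : ∀ g ∈ (H : Set G), ∀ v : List X, hX.sect g v ∈ (H : Set G) :=
    fun g hg v => hX.sect_mem_closure_nucleus h hg v
  have hHa : hX.Absorbs H := fun g =>
    (hX.absorbs_nucleus h g).imp fun n hn v hv => Subgroup.subset_closure (hn v hv)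
  have has : ∀ {x y : LeftSeq X}, hX.asymptotic x y ↔ ∀ n, hX.LevelRel H n x y :=
    hX.asymptotic_iff hfin hHa
  have symm : ∀ {n} {x y : LeftSeq X}, hX.LevelRel H n x y → hX.LevelRel H n y x := by
    rintro n x y ⟨g, hg, e⟩
    exact ⟨g⁻¹, inv_mem hg, by rw [← e, act_inv_act]⟩
  have trans : ∀ {n} {x y z : LeftSeq X}, hX.LevelRel H n x y → hX.LevelRel H n y z →
      hX.LevelRel H n x z := by
    rintro n x y z ⟨g, hg, e⟩ ⟨g', hg', e'⟩
    exact ⟨g' * g, mul_mem hg' hg, by rw [act_mul, e, e']⟩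
  have refl : ∀ n (x : LeftSeq X), hX.LevelRel H n x x :=
    fun n x => ⟨1, one_mem _, hX.act_one _⟩
  intro U hUo hUc
  let π : LeftSeq X → hX.LimitSpace := Quotient.mk hX.asymptotic
  obtain ⟨n, hn⟩ : ∃ n, ∀ x, ∃ s ∈ U, ∀ y, hX.LevelRel H n x y → π y ∈ s := by
    refine LeftSeq.exists_eq_univ (fun n => {x | ∃ s ∈ U, ∀ y, hX.LevelRel H n x y → π y ∈ s})
      (fun n => ?_) (fun m n hmn x hx => ?_) fun x => ?_
    · refine LeftSeq.isOpen_iff.2 fun x hx => ⟨n, fun x' hx' => ?_⟩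
      simpa only [Set.mem_ofPred_eq, LevelRel, hx'] using hx
    · obtain ⟨s, hs', hx⟩ := hx
      exact ⟨s, hs', fun y hy => hx y (hy.of_le hs hmn)⟩
    · obtain ⟨s, hsU, hxs⟩ := Set.mem_sUnion.1 (hUc ▸ Set.mem_univ (π x))
      obtain ⟨n, hn⟩ := hX.exists_levelRel_subset hs (hX.isOpen_limitSpace_iff.1 (hUo s hsU)) x
        fun y hy => by
          rwa [Set.mem_ofPred_eq, ← (Quotient.sound (has.2 hy) : π x = π y)]
      exact ⟨n, s, hsU, hn⟩
  let V : LeftSeq X → Set hX.LimitSpace := fun x => {q | ∃ y, hX.LevelRel H n x y ∧ π y = q}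
  -- The class of `x` on level `n` is saturated, since asymptotic sequences are related on every
  -- level.
  have hV : ∀ x y, π y ∈ V x ↔ hX.LevelRel H n x y := by
    refine fun x y => ⟨?_, fun hxy => ⟨y, hxy, rfl⟩⟩
    rintro ⟨z, hz, e⟩
    exact trans hz (has.1 (Quotient.exact e) n)
  refine ⟨Set.range V, ?_, ?_, ?_, fun p => ?_⟩
  · rintro _ ⟨x, rfl⟩
    rw [isOpen_limitSpace_iff]
    change IsOpen {y | π y ∈ V x}
    simp only [hV]
    exact LeftSeq.isOpen_setOf_ending n fun v => ∃ g ∈ (H : Set G), hX.act g (x.ending n) = v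
  · refine Set.eq_univ_of_forall fun q => ?_
    obtain ⟨x, rfl⟩ := Quotient.exists_rep q
    exact ⟨V x, ⟨x, rfl⟩, (hV x x).2 (refl n x)⟩
  · rintro _ ⟨x, rfl⟩
    obtain ⟨s, hsU, hx⟩ := hn x
    refine ⟨s, hsU, ?_⟩
    rintro _ ⟨y, hy, rfl⟩
    exact hx y hy
  · obtain ⟨z, rfl⟩ := Quotient.exists_rep p
    simp only [Nat.cast_zero, zero_add]
    rw [Set.encard_le_one_iff]
    rintro _ _ ⟨⟨x, rfl⟩, hx⟩ ⟨⟨y, rfl⟩, hy⟩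
    have hxy := trans ((hV x z).1 hx) (symm ((hV y z).1 hy))
    ext q
    obtain ⟨t, rfl⟩ := Quotient.exists_rep q
    exact (hV x t).trans ((⟨fun h => trans (symm hxy) h, fun h => trans hxy h⟩ :
      _ ↔ hX.LevelRel H n y t).trans (hV y t).symm)

end IsBasis

/-! ### From dimension zero to a finite group -/

namespace IsBasis

variable {G B : Type*} [Group G] [MulAction G B] [MulAction Gᵐᵒᵖ B] [SMulCommClass G Gᵐᵒᵖ B]
  [IsSelfSimilarGroup G B] {X : Set B}

/-- The sections that elements of `N³` can have in long endings of `x` fixed by them form a finite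
set `C` closed under multiplication, and a single ending detects whether a section is in `C`. -/
theorem exists_isotropy [Nonempty X] (hX : IsBasis G B X)
    (h : ∃ N : Set G, N.Finite ∧ hX.Absorbs N) (x : LeftSeq X) :
    ∃ (C : Set G) (K : ℕ), C ⊆ hX.nucleus ^ 3 ∧ (∀ a ∈ C, ∀ b ∈ C, a * b ∈ C) ∧
      ∀ g ∈ hX.nucleus ^ 3, hX.act g (x.ending K) = x.ending K → hX.sect g (x.ending K) ∈ C := by
  have hN := hX.finite_nucleus h
  have hs : ∀ g ∈ hX.nucleus ^ 3, ∀ v : List X, hX.sect g v ∈ hX.nucleus ^ 3 := fun g hg v =>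
    hX.sect_mem_pow (k := 0) (fun g hg v _ => hX.sect_mem_nucleus h hg v) 3 g hg v (Nat.zero_le _)
  have hN3 : hX.nucleus ⊆ hX.nucleus ^ 3 := by
    simpa using Set.pow_subset_pow_right (hX.one_mem_nucleus h) (show 1 ≤ 3 by norm_num)
  let P : ℕ → G → Prop := fun n c =>
    ∃ g ∈ hX.nucleus ^ 3, hX.act g (x.ending n) = x.ending n ∧ hX.sect g (x.ending n) = c
  have hP : ∀ {m n c}, m ≤ n → P n c → P m c := by
    rintro m n _ hmn ⟨g, hg, e, rfl⟩
    obtain ⟨k, rfl⟩ := Nat.exists_eq_add_of_le hmn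
    obtain ⟨p, -, hp, h'⟩ := hX.exists_sect_act_ending e
    exact ⟨_, hs g hg p, h', by rw [hp, sect_append]⟩
  have hP0 : ∀ {n c}, P n c → c ∈ hX.nucleus ^ 3 := by
    rintro n _ ⟨g, hg, -, rfl⟩
    exact hs g hg _
  -- The sets `{c | P n c}` decrease in `n` inside the finite set `N³`, so they become constant.
  have hK : ∀ᶠ n : ℕ in Filter.atTop, ∀ c ∈ hX.nucleus ^ 3, P n c → ∀ k, P k c := by
    refine (Filter.eventually_all_finite (hN.pow_set 3)).2 fun c _ => ?_
    by_cases hc : ∀ k, P k c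
    · exact Filter.Eventually.of_forall fun n _ => hc
    · obtain ⟨k, hk⟩ := not_forall.1 hc
      filter_upwards [Filter.eventually_ge_atTop k] with n hn hPn
      exact absurd (hP hn hPn) hk
  obtain ⟨K, hK⟩ := hK.exists
  refine ⟨{c | ∀ n, P n c}, K, fun c hc => hP0 (hc 0), fun a ha b hb n => ?_,
    fun g hg e => hK _ (hs g hg _) ⟨g, hg, e, rfl⟩⟩
  -- Products of witnesses lie only in `N³·N³`. Witnesses are taken `k` levels deeper, where the
  -- section of the product in the first `k` letters is back in `N`.
  obtain ⟨k, hk⟩ := Absorbs.eventually hX (hX.absorbs_nucleus h)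
    ((hN.pow_set 3).mul (hN.pow_set 3))
  obtain ⟨g, hg, e, rfl⟩ := ha (n + k)
  obtain ⟨g', hg', e', rfl⟩ := hb (n + k)
  have e'' : hX.act (g * g') (x.ending (n + k)) = x.ending (n + k) := by rw [act_mul, e', e]
  obtain ⟨p, hpl, hp, h'⟩ := hX.exists_sect_act_ending e''
  refine ⟨hX.sect (g * g') p, hN3 (hk _ (Set.mul_mem_mul hg hg') p hpl.ge), h', ?_⟩
  rw [← sect_append, ← hp, sect_mul, e']

/-- The points with representatives whose endings of length `K` are all related to that of `x`. -/
def neighborhood (hX : IsBasis G B X) (x : LeftSeq X) (K : ℕ) : Set hX.LimitSpace :=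
  {q | ∀ y : LeftSeq X, Quotient.mk hX.asymptotic y = q → hX.LevelRel hX.nucleus K x y}

/-- By compactness the condition on the asymptotic class of `z` already holds for all sequences
related to `z` on some level `n`, and this depends only on the ending of `z` of length `n`. -/
theorem isOpen_neighborhood (hX : IsBasis G B X) (h : ∃ N : Set G, N.Finite ∧ hX.Absorbs N)
    (x : LeftSeq X) (K : ℕ) : IsOpen (hX.neighborhood x K) := by
  have has {x y} := hX.asymptotic_iff (hX.finite_nucleus h) (hX.absorbs_nucleus h) (x := x) (y := y)
  rw [isOpen_limitSpace_iff, LeftSeq.isOpen_iff]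
  intro z hz
  obtain ⟨n, hn⟩ := hX.exists_levelRel_subset (fun g hg v => hX.sect_mem_nucleus h hg v)
    (W := {y | hX.LevelRel hX.nucleus K x y})
    (LeftSeq.isOpen_setOf_ending K fun v => ∃ g ∈ hX.nucleus, hX.act g (x.ending K) = v) z
    (fun y hy => hz y (Quotient.sound (has.2 hy)).symm)
  refine ⟨n, fun z' hz' y hy => hn y ?_⟩
  have := has.1 (Quotient.exact hy.symm) n
  rwa [LevelRel, hz'] at this

theorem mk_mem_neighborhood (hX : IsBasis G B X) (h : ∃ N : Set G, N.Finite ∧ hX.Absorbs N)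
    (x : LeftSeq X) (K : ℕ) :
    (Quotient.mk hX.asymptotic x : hX.LimitSpace) ∈ hX.neighborhood x K := fun _ hy =>
  (hX.asymptotic_iff (hX.finite_nucleus h) (hX.absorbs_nucleus h)).1 (Quotient.exact hy.symm) K

/-- A set of words of a fixed length that is invariant under the nucleus and whose endings all lie
in one orbit of the nucleus has small sections of products of elements of the nucleus. -/
theorem sect_mem_of_invariant [Nonempty X] (hX : IsBasis G B X)
    (h : ∃ N : Set G, N.Finite ∧ hX.Absorbs N) {C : Set G} (hC : C ⊆ hX.nucleus ^ 3)
    (hCm : ∀ a ∈ C, ∀ b ∈ C, a * b ∈ C) {u : List X}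
    (hu : ∀ g ∈ hX.nucleus ^ 3, hX.act g u = u → hX.sect g u ∈ C) {S : Set (List X)}
    (hS : ∀ w ∈ S, ∀ g ∈ hX.nucleus, hX.act g w ∈ S) {j : ℕ} (hj : ∀ w ∈ S, j ≤ w.length)
    (hSu : ∀ w ∈ S, ∃ a ∈ hX.nucleus, hX.act a u = w.drop j) {g : G}
    (hg : g ∈ Subgroup.closure hX.nucleus) {v : List X} (hv : v ∈ S) :
    hX.sect g v ∈ hX.nucleus ^ 5 := by
  -- With `p` the first `j` letters of `w`, the element `b⁻¹ · n|_p · a` of `N³` fixes `u`, and its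
  -- section there is the displayed product.
  have step : ∀ n ∈ hX.nucleus, ∀ w ∈ S, ∀ a ∈ hX.nucleus, ∀ b ∈ hX.nucleus,
      hX.act a u = w.drop j → hX.act b u = (hX.act n w).drop j →
      (hX.sect b u)⁻¹ * hX.sect n w * hX.sect a u ∈ C := by
    intro n hn w hw a ha b hb ea eb
    have hl : (w.take j).length = j := by simpa using hj w hw
    have e : (hX.act n w).drop j = hX.act (hX.sect n (w.take j)) (w.drop j) := by
      conv_lhs => rw [← List.take_append_drop j w, act_append]
      exact List.drop_left' (by rw [length_act, hl])
    rw [e, ← ea] at eb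
    have e' : hX.sect n w = hX.sect (hX.sect n (w.take j)) (hX.act a u) := by
      rw [ea, ← sect_append, List.take_append_drop]
    have := hu (b⁻¹ * hX.sect n (w.take j) * a) (by
      rw [pow_three']
      exact Set.mul_mem_mul (Set.mul_mem_mul (hX.inv_mem_nucleus h hb)
        (hX.sect_mem_nucleus h hn _)) ha) (by rw [act_mul, act_mul, ← eb, act_inv_act])
    rwa [sect_mul, sect_mul, ← eb, sect_inv_act, ← e'] at this
  have key : hX.act g v ∈ S ∧ ∀ a ∈ hX.nucleus, ∀ b ∈ hX.nucleus,
      hX.act a u = v.drop j → hX.act b u = (hX.act g v).drop j →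
      (hX.sect b u)⁻¹ * hX.sect g v * hX.sect a u ∈ C := by
    have mul_left : ∀ n ∈ hX.nucleus, ∀ g : G, (hX.act g v ∈ S ∧
        ∀ a ∈ hX.nucleus, ∀ b ∈ hX.nucleus,
          hX.act a u = v.drop j → hX.act b u = (hX.act g v).drop j →
          (hX.sect b u)⁻¹ * hX.sect g v * hX.sect a u ∈ C) →
        (hX.act (n * g) v ∈ S ∧ ∀ a ∈ hX.nucleus, ∀ b ∈ hX.nucleus,
          hX.act a u = v.drop j → hX.act b u = (hX.act (n * g) v).drop j →
          (hX.sect b u)⁻¹ * hX.sect (n * g) v * hX.sect a u ∈ C) := by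
      rintro n hn g ⟨hg, hga⟩
      rw [act_mul]
      refine ⟨hS _ hg n hn, fun a ha b hb ea eb => ?_⟩
      obtain ⟨c, hc, ec⟩ := hSu _ hg
      -- The factors from the intermediate word, `c|_u` and its inverse, cancel.
      have := hCm _ (step n hn _ hg c hc b hb ec eb) _ (hga a ha c hc ea ec)
      rw [sect_mul]
      convert this using 1
      group
    induction hg using Subgroup.closure_induction_left with
    | one =>
      refine ⟨by rwa [act_one], fun a ha b hb ea eb => ?_⟩
      exact step 1 (hX.one_mem_nucleus h) v hv a ha b hb ea eb
    | mul_left n hn g _ ih => exact mul_left n hn g ih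
    | inv_mul_cancel n hn g _ ih => exact mul_left _ (hX.inv_mem_nucleus h hn) g ih
  obtain ⟨a, ha, ea⟩ := hSu v hv
  obtain ⟨b, hb, eb⟩ := hSu _ key.1
  have hc := hC (key.2 a ha b hb ea eb)
  have : hX.sect g v = hX.sect b u * ((hX.sect b u)⁻¹ * hX.sect g v * hX.sect a u) *
      (hX.sect a u)⁻¹ := by group
  rw [this, pow_succ, pow_succ']
  exact Set.mul_mem_mul (Set.mul_mem_mul (hX.sect_mem_nucleus h hb u) hc)
    (hX.inv_mem_nucleus h (hX.sect_mem_nucleus h ha u))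

/-- If the limit space is zero-dimensional, then the elements of the group generated by the nucleus
have boundedly many sections on some level. -/
theorem exists_level_sect_mem [Nonempty X] (hX : IsBasis G B X)
    (h : ∃ N : Set G, N.Finite ∧ hX.Absorbs N) (hz : IsZeroDimensional hX.LimitSpace) :
    ∃ m : ℕ, ∀ g ∈ Subgroup.closure hX.nucleus, ∀ v : List X, v.length = m →
      hX.sect g v ∈ hX.nucleus ^ 5 := by
  have := hX.finite
  choose C K hC hCm hCK using hX.exists_isotropy h
  let π : LeftSeq X → hX.LimitSpace := Quotient.mk hX.asymptotic
  obtain ⟨V, hVo, hVc, hVr, hVd⟩ := hz (Set.range fun x => hX.neighborhood x (K x))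
    (by rintro _ ⟨x, rfl⟩; exact hX.isOpen_neighborhood h x _)
    (by
      refine Set.eq_univ_of_forall fun q => ?_
      obtain ⟨x, rfl⟩ := Quotient.exists_rep q
      exact ⟨_, ⟨x, rfl⟩, hX.mk_mem_neighborhood h x _⟩)
  have disj : ∀ s ∈ V, ∀ t ∈ V, ∀ q, q ∈ s → q ∈ t → s = t := by
    intro s hs t ht q hqs hqt
    have := hVd q
    rw [Nat.cast_zero, zero_add, Set.encard_le_one_iff] at this
    exact this s t ⟨hs, hqs⟩ ⟨ht, hqt⟩
  obtain ⟨m, hm⟩ : ∃ m, ∀ y : LeftSeq X, ∃ s ∈ V, ∃ x, K x ≤ m ∧ s ⊆ hX.neighborhood x (K x) ∧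
      ∀ z : LeftSeq X, z.ending m = y.ending m → π z ∈ s := by
    refine LeftSeq.exists_eq_univ (fun m => {y | ∃ s ∈ V, ∃ x, K x ≤ m ∧
      s ⊆ hX.neighborhood x (K x) ∧ ∀ z : LeftSeq X, z.ending m = y.ending m → π z ∈ s})
      (fun m => ?_) (fun m n hmn y hy => ?_) fun y => ?_
    · exact LeftSeq.isOpen_setOf_ending m fun v => ∃ s ∈ V, ∃ x, K x ≤ m ∧
        s ⊆ hX.neighborhood x (K x) ∧ ∀ z : LeftSeq X, z.ending m = v → π z ∈ s
    · obtain ⟨s, hs, x, hx, hsx, hy⟩ := hy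
      exact ⟨s, hs, x, hx.trans hmn, hsx, fun z hz => hy z (LeftSeq.ending_eq_of_le hmn hz)⟩
    · obtain ⟨s, hs, hys⟩ := Set.mem_sUnion.1 (hVc ▸ Set.mem_univ (π y))
      obtain ⟨_, ⟨x, rfl⟩, hsx⟩ := hVr s hs
      obtain ⟨n, hn⟩ := LeftSeq.isOpen_iff.1 (hX.isOpen_limitSpace_iff.1 (hVo s hs)) y hys
      exact ⟨max (K x) n, s, hs, x, le_max_left _ _, hsx,
        fun z hz => hn z (LeftSeq.ending_eq_of_le (le_max_right _ _) hz)⟩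
  have ext : ∀ w : List X, ∃ z : LeftSeq X, z.ending w.length = w := fun w =>
    (LeftSeq.exists_ending_eq w fun _ => Classical.arbitrary X).imp fun z hz => hz.1
  refine ⟨m, fun g hg v hv => ?_⟩
  obtain ⟨y, hy⟩ := ext v
  obtain ⟨s, hs, x, hx, hsx, hys⟩ := hm y
  rw [← hv, hy, hv] at hys
  refine hX.sect_mem_of_invariant h (hC x) (hCm x) (hCK x) (j := m - K x)
    (S := {w | w.length = m ∧ ∀ z : LeftSeq X, z.ending m = w → π z ∈ s}) ?_ ?_ ?_ hg ⟨hv, hys⟩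
  · rintro w ⟨hw, hws⟩ n hn
    refine ⟨by simpa using hw, fun z hz => ?_⟩
    obtain ⟨x', y', hxy, hx', hy'⟩ := hX.exists_asymptotic_of_mem_nucleus h hn w
    rw [hw] at hx' hy'
    have hy's : π y' ∈ s := by
      have e : π x' = π y' := Quotient.sound hxy
      rw [← e]
      exact hws x' hx'
    obtain ⟨t, ht, -, -, -, htz⟩ := hm y'
    -- The cylinder of `n(w)` lies over a single member of the disjoint cover, and it meets `s` in
    -- `π y'`.
    rw [disj s hs t ht _ hy's (htz y' rfl)]
    exact htz z (hz.trans hy'.symm)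
  · rintro w ⟨hw, -⟩
    omega
  · rintro w ⟨hw, hws⟩
    obtain ⟨z, hz⟩ := ext w
    rw [hw] at hz
    obtain ⟨a, ha, e⟩ := hsx (hws z hz) z rfl
    refine ⟨a, ha, e.trans ?_⟩
    obtain ⟨p, hp, e'⟩ := z.exists_ending_add (K x) (m - K x)
    rw [Nat.add_sub_cancel' hx, hz] at e'
    rw [e', List.drop_left' hp]

/-- If the limit space of a faithful contracting group is zero-dimensional, then the group generated
by the nucleus is finite. -/
theorem IsFaithful.finite_closure_nucleus {hX : IsBasis G B X} (hf : hX.IsFaithful)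
    (h : ∃ N : Set G, N.Finite ∧ hX.Absorbs N) (hz : IsZeroDimensional hX.LimitSpace) :
    Finite (Subgroup.closure hX.nucleus) := by
  -- Over the empty alphabet the only word is empty, so faithfulness makes `G` trivial.
  obtain hE | hE := isEmpty_or_nonempty X
  · have : Subsingleton G := subsingleton_of_forall_eq 1 fun g => hf g fun v => by
      rw [Subsingleton.elim v []]; rfl
    infer_instance
  · obtain ⟨m, hm⟩ := hX.exists_level_sect_mem h hz
    exact hf.finite_of_sect_mem (S := (Subgroup.closure hX.nucleus : Set G))
      ((hX.finite_nucleus h).pow_set 5) m hm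

end IsBasis

end SelfSim

theorem mainTheorem6 {G B : Type*} [Group G] [MulAction G B] [MulAction Gᵐᵒᵖ B]
    [SMulCommClass G Gᵐᵒᵖ B] [SelfSim.IsSelfSimilarGroup G B]
    (hG : SelfSim.IsContracting G B) (X : Set B) (hX : SelfSim.IsBasis G B X) :
    (hX.IsFaithful →
      List.TFAE [SelfSim.IsZeroDimensional hX.LimitSpace,
        SelfSim.IsLocallyFinite G,
        Finite (Subgroup.closure hX.nucleus)]) ∧
    (SelfSim.IsLocallyFinite G → Finite (Subgroup.closure hX.nucleus)) ∧
    (Finite (Subgroup.closure hX.nucleus) → SelfSim.IsZeroDimensional hX.LimitSpace) := by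
  have h := hX.exists_absorbs hG
  have h23 : SelfSim.IsLocallyFinite G → Finite (Subgroup.closure hX.nucleus) := fun hl =>
    hl _ (Subgroup.fg_iff _ |>.2 ⟨_, rfl, hX.finite_nucleus h⟩)
  have h31 := hX.isZeroDimensional h
  refine ⟨fun hf => ?_, h23, h31⟩
  tfae_have 1 → 3 := hf.finite_closure_nucleus h
  tfae_have 3 → 2 := hf.isLocallyFinite h
  tfae_have 2 → 3 := h23
  tfae_have 3 → 1 := h31
  tfae_finish
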